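/- Let $Q\subseteq\mathbb C^n$ be nonempty, closed and convex, let $\nu\in[0,1]$ and $M_\nu>0$, and let $q:\mathbb C^n\to\mathbb R$ be convex and Hölder smooth over $Q$, i.e. $\|u-w\|\le M_\nu\|x-y\|^\nu$ for all $x,y\in Q$, $u\in\partial q(x)$, $w\in\partial q(y)$ (with $0^0=1$; $\|\cdot\|$ is the Euclidean norm and $\langle x,y\rangle_{\mathbb R}=\operatorname{Re}\langle x,y\rangle$). Let $g:\mathbb C^n\to(-\infty,\infty]$ be a proper closed convex function that is finite on $Q$, put $f=q+g$, $\hat f=\inf_Q f$, and suppose that the set $\widehat X$ of minimizers of $f$ over $Q$ is nonempty. The universal fast gradient method with parameters $\epsilon>0$, $L_0>0$ and starting point $x_0\in Q$ is the following. Write $\mathrm{prox}_{\varphi,Q}(c)=\operatorname{argmin}_{z\in Q}\{\varphi(z)+\tfrac12\|c-z\|^2\}$. Set $\phi_0=0$, $y_0=x_0$, $A_0=0$. For $k=0,1,2,\dots$ let $v_k=\mathrm{prox}_{\phi_k,Q}(x_0)$; for $i=0,1,2,\dots$ let $a_i>0$ solve $a_i^2=\frac{1}{2^iL_k}(A_k+a_i)$,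 put $\tau_i=a_i/(A_k+a_i)$, $x^{(i)}=\tau_iv_k+(1-\tau_i)y_k$, choose any $u_i\in\partial q(x^{(i)})$, and put $\hat x^{(i)}=\mathrm{prox}_{\hat\phi_i,Q}(v_k)$ with $\hat\phi_i(z)=a_i[\langle u_i,z\rangle_{\mathbb R}+g(z)]$, $y^{(i)}=\tau_i\hat x^{(i)}+(1-\tau_i)y_k$, stopping at the first $i=i_k$ with $$q(y^{(i)})\le q(x^{(i)})+\langle u_i,y^{(i)}-x^{(i)}\rangle_{\mathbb R}+2^{i-1}L_k\|y^{(i)}-x^{(i)}\|^2+\tfrac{\epsilon}{2}\tau_i .$$ Then set $x_{k+1}=x^{(i_k)}$, $y_{k+1}=y^{(i_k)}$, $A_{k+1}=A_k+a_{i_k}$, $L_{k+1}=2^{i_k-1}L_k$ and $\phi_{k+1}(z)=\phi_k(z)+a_{i_k}[q(x_{k+1})+\langle u_{i_k},z-x_{k+1}\rangle_{\mathbb R}+g(z)]$. The output after $N$ iterations is $y_N$. For $\delta\ge0$ and $\epsilon>0$ let $$N=N(\delta,\epsilon)=\left\lceil\frac{2^{\frac{2+4\nu}{1+3\nu}}M_\nu^{\frac{2}{1+3\nu}}\delta^{\frac{2+2\nu}{1+3\nu}}}{\epsilon^{\frac{2}{1+3\nu}}}\right\rceil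 .$$ Then: 1. For all $\delta\ge 0$, $\epsilon>0$, $L_0>0$, $x_0\in Q$ and all choices of subgradients, the method can be run for $N$ iterations (all proximal points exist and every inner loop stops). If moreover $L_0\le 2M_\nu^{\frac{2}{1+\nu}}\epsilon^{-\frac{1-\nu}{1+\nu}}$ and $d(x_0,\widehat X)\le\delta$ (Euclidean distance), then the output $\Gamma(\delta,\epsilon,x_0)=y_N$ of every such run lies in $Q$ and satisfies $f(\Gamma(\delta,\epsilon,x_0))-\hat f\le\epsilon$. 2. Consequently one may take the iteration cost $\mathcal C_\Gamma(\delta,\epsilon)=N(\delta,\epsilon)$, and for $C=2^{\frac{2+4\nu}{1+3\nu}}M_\nu^{\frac{2}{1+3\nu}}>0$, $d_1=\frac{2+2\nu}{1+3\nu}>0$ and $d_2=\frac{2}{1+3\nu}>0$ it satisfies $N(\delta,\epsilon)\le C\delta^{d_1}/\epsilon^{d_2}+1$ for all $\delta,\epsilon>0$. -/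

import Mathlib

noncomputable section

namespace UFGM

/-- The space `ℂⁿ` with its Euclidean norm. -/
abbrev CVec (n : ℕ) : Type := EuclideanSpace ℂ (Fin n)

/-- The real inner product `⟨x, y⟩_ℝ = Re ⟨x, y⟩` on `ℂⁿ`. -/
def reInner {n : ℕ} (x y : CVec n) : ℝ := (inner ℂ x y : ℂ).re

/-- The subdifferential of a finite function `q : ℂⁿ → ℝ` at `x`. -/
def subdifferential {n : ℕ} (q : CVec n → ℝ) (x : CVec n) : Set (CVec n) :=
  {u | ∀ z, q x + reInner u (z - x) ≤ q z}

/-- `q : ℂⁿ → ℝ` is convex and Hölder smooth over `Q` with parameter `ν` and constant `M`.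
For `ν = 0` the convention `0 ^ 0 = 1` is in force. -/
structure IsHolderSmooth {n : ℕ} (q : CVec n → ℝ) (Q : Set (CVec n)) (ν M : ℝ) : Prop where
  convex : ConvexOn ℝ Set.univ q
  holder : ∀ x ∈ Q, ∀ y ∈ Q, ∀ u ∈ subdifferential q x, ∀ w ∈ subdifferential q y,
    ‖u - w‖ ≤ M * ‖x - y‖ ^ ν

/-- `g : ℂⁿ → (-∞, ∞]` is a proper closed convex function
(properness, and convexity and closedness of the epigraph). -/
structure IsProperClosedConvex {n : ℕ} (g : CVec n → EReal) : Prop where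
  ne_bot : ∀ x, g x ≠ ⊥
  exists_ne_top : ∃ x, g x ≠ ⊤
  convex_epigraph : Convex ℝ {p : CVec n × ℝ | g p.1 ≤ (p.2 : EReal)}
  closed_epigraph : IsClosed {p : CVec n × ℝ | g p.1 ≤ (p.2 : EReal)}

/-- The effective domain of an extended-valued function. -/
def effectiveDomain {n : ℕ} (g : CVec n → EReal) : Set (CVec n) := {x | g x < ⊤}

/-- The objective function `f = q + g`. -/
def objective {n : ℕ} (q : CVec n → ℝ) (g : CVec n → EReal) (x : CVec n) : EReal :=
  (q x : EReal) + g x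

/-- The optimal value of `f` over `Q`. -/
def optimalValue {n : ℕ} (f : CVec n → EReal) (Q : Set (CVec n)) : EReal := ⨅ x ∈ Q, f x

/-- The set of minimizers of `f` over `Q`. -/
def minimizers {n : ℕ} (f : CVec n → EReal) (Q : Set (CVec n)) : Set (CVec n) :=
  {x | x ∈ Q ∧ f x = optimalValue f Q}

/-- `z = prox_{φ,Q}(c)`, that is, `z` minimizes `φ(w) + ‖c - w‖² / 2` over `w ∈ Q`. -/
def IsProx {n : ℕ} (φ : CVec n → EReal) (Q : Set (CVec n)) (c z : CVec n) : Prop :=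
  z ∈ Q ∧ ∀ w ∈ Q, φ z + ((‖c - z‖ ^ 2 / 2 : ℝ) : EReal) ≤ φ w + ((‖c - w‖ ^ 2 / 2 : ℝ) : EReal)

/-- The quantities `a_{k+1,i}, A_{k+1,i}, τ_{k,i}, x_{k+1,i}, ∇q(x_{k+1,i}), x̂_{k+1,i}, y_{k+1,i}`
computed in one pass through the inner (line search) loop. -/
structure Trial (n : ℕ) where
  a : ℝ
  A : ℝ
  τ : ℝ
  x : CVec n
  u : CVec n
  xhat : CVec n
  y : CVec n

/-- `t` is the result of pass number `i` through the inner loop, started from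
`v = v_k`, `y = y_k`, `A = A_k`, `L = L_k`. -/
structure IsTrial {n : ℕ} (Q : Set (CVec n)) (q : CVec n → ℝ) (g : CVec n → EReal)
    (v y : CVec n) (A L : ℝ) (i : ℕ) (t : Trial n) : Prop where
  a_pos : 0 < t.a
  a_eq : t.a ^ 2 = 1 / (2 ^ i * L) * (A + t.a)
  A_eq : t.A = A + t.a
  τ_eq : t.τ = t.a / t.A
  x_eq : t.x = t.τ • v + (1 - t.τ) • y
  u_mem : t.u ∈ subdifferential q t.x
  xhat_prox : IsProx (fun z => (t.a : EReal) * ((reInner t.u z : EReal) + g z)) Q v t.xhat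
  y_eq : t.y = t.τ • t.xhat + (1 - t.τ) • y

/-- The condition under which the inner loop stops after pass number `i`
(the negation of the "while" condition). -/
def Accepted {n : ℕ} (q : CVec n → ℝ) (ε L : ℝ) (i : ℕ) (t : Trial n) : Prop :=
  q t.y ≤ q t.x + reInner t.u (t.y - t.x) + 2 ^ i / 2 * L * ‖t.y - t.x‖ ^ 2 + ε / 2 * t.τ

/-- The record of an execution of the universal fast gradient method. Here `i k` is the index of
the last pass through the inner loop in iteration `k`, and `trial k j` is pass number `j` there. -/
structure Run (n : ℕ) where
  v : ℕ → CVec n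
  x : ℕ → CVec n
  y : ℕ → CVec n
  A : ℕ → ℝ
  L : ℕ → ℝ
  φ : ℕ → CVec n → EReal
  i : ℕ → ℕ
  trial : ℕ → ℕ → Trial n

/-- `r` records the iterations `k = 0, …, N - 1` of the universal fast gradient method with
parameters `ε` and `L₀`, started at `x₀`. After them `y_N = r.y N` is available. -/
structure IsRun {n : ℕ} (Q : Set (CVec n)) (q : CVec n → ℝ) (g : CVec n → EReal)
    (ε L₀ : ℝ) (x₀ : CVec n) (N : ℕ) (r : Run n) : Prop where
  x_zero : r.x 0 = x₀
  y_zero : r.y 0 = x₀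
  A_zero : r.A 0 = 0
  L_zero : r.L 0 = L₀
  φ_zero : ∀ z, r.φ 0 z = 0
  v_prox : ∀ k < N, IsProx (r.φ k) Q x₀ (r.v k)
  trials : ∀ k < N, ∀ j ≤ r.i k,
    IsTrial Q q g (r.v k) (r.y k) (r.A k) (r.L k) j (r.trial k j)
  rejected : ∀ k < N, ∀ j < r.i k, ¬ Accepted q ε (r.L k) j (r.trial k j)
  accepted : ∀ k < N, Accepted q ε (r.L k) (r.i k) (r.trial k (r.i k))
  x_succ : ∀ k < N, r.x (k + 1) = (r.trial k (r.i k)).x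
  y_succ : ∀ k < N, r.y (k + 1) = (r.trial k (r.i k)).y
  A_succ : ∀ k < N, r.A (k + 1) = r.A k + (r.trial k (r.i k)).a
  L_succ : ∀ k < N, r.L (k + 1) = 2 ^ (r.i k) / 2 * r.L k
  φ_succ : ∀ k < N, ∀ z, r.φ (k + 1) z = r.φ k z + ((r.trial k (r.i k)).a : EReal) *
    (((q (r.x (k + 1)) + reInner (r.trial k (r.i k)).u (z - r.x (k + 1)) : ℝ) : EReal) + g z)

/-- The number of iterations
`N = ⌈2^((2+4ν)/(1+3ν)) M^(2/(1+3ν)) δ^((2+2ν)/(1+3ν)) / ε^(2/(1+3ν))⌉`. -/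
def iterationCount (ν M δ ε : ℝ) : ℕ :=
  ⌈(2 : ℝ) ^ ((2 + 4 * ν) / (1 + 3 * ν)) * M ^ (2 / (1 + 3 * ν)) *
    δ ^ ((2 + 2 * ν) / (1 + 3 * ν)) / ε ^ (2 / (1 + 3 * ν))⌉₊

end UFGM

end

noncomputable section

open Set Filter Topology

namespace UFGM

variable {n : ℕ} {Q : Set (CVec n)} {q : CVec n → ℝ} {g : CVec n → EReal}

/-! ### The real inner product -/

/-! The proof uses Nesterov's estimating sequences. On `Q` each `φ_k` is `A_k g` plus an affine
function, and two bounds persist (`IsRun.estimates`): `A_k (f(y_k) - ε/2) ≤ φ_k(z) + ‖x₀ - z‖²/2`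
and `φ_k(z) ≤ A_k f(z)`. At a minimizer `z` nearest to `x₀` they give `f(y_N) - f̂ ≤ ε/2 + δ²/(2
A_N)`, so `A_N ≥ δ²/ε` suffices.

The size of `A_N` comes from the line search. Write `S = 2^i L_k`. Hölder smoothness gives a descent
inequality with exponent `1 + ν`, and Young's inequality turns it into the acceptance test as soon
as `M ≤ S^((1+ν)/2) (ε τ)^((1-ν)/2)` (`IsHolderSmooth.accepted`). Hence inner loops stop. Since a
rejected pass violates this condition, `L_{k+1}` is bounded in terms of `A_{k+1}`
(`IsRun.log_L_le`). With `S a² = A_{k+1}` this yields `a ≥ c A_{k+1}^(1-θ)` for `θ = (1+ν)/(1+3ν)`,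
so `A_k^θ` grows at least linearly (`IsRun.growth`).

Power inequalities are handled through logarithms, where they become linear. -/

theorem reInner_add_right (u x y : CVec n) : reInner u (x + y) = reInner u x + reInner u y := by
  simp [reInner]

theorem reInner_add_left (u x y : CVec n) : reInner (x + y) u = reInner x u + reInner y u := by
  simp [reInner]

theorem reInner_sub_right (u x y : CVec n) : reInner u (x - y) = reInner u x - reInner u y := by
  simp [reInner]

theorem reInner_sub_left (u x y : CVec n) : reInner (x - y) u = reInner x u - reInner y u := by
  simp [reInner]

theorem reInner_smul_right (t : ℝ) (u x : CVec n) : reInner u (t • x) = t * reInner u x := by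
  simp [reInner, inner_smul_right_eq_smul]

theorem reInner_smul_left (t : ℝ) (u x : CVec n) : reInner (t • x) u = t * reInner x u := by
  simp [reInner, inner_smul_left_eq_smul]

theorem reInner_comm (x y : CVec n) : reInner x y = reInner y x :=
  inner_re_symm (𝕜 := ℂ) x y

theorem reInner_self (x : CVec n) : reInner x x = ‖x‖ ^ 2 :=
  inner_self_eq_norm_sq (𝕜 := ℂ) x

theorem reInner_le_norm_mul_norm (x y : CVec n) : reInner x y ≤ ‖x‖ * ‖y‖ :=
  re_inner_le_norm (𝕜 := ℂ) x y

theorem continuous_reInner (u : CVec n) : Continuous (reInner u) :=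
  Complex.continuous_re.comp (continuous_const.inner continuous_id)

/-- The squared norm along a segment. -/
theorem norm_sq_segment (c v z : CVec n) (t : ℝ) :
    ‖c - ((1 - t) • v + t • z)‖ ^ 2 =
      (1 - t) * ‖c - v‖ ^ 2 + t * ‖c - z‖ ^ 2 - t * (1 - t) * ‖z - v‖ ^ 2 := by
  simp only [← reInner_self, reInner_sub_right, reInner_sub_left, reInner_add_left,
    reInner_add_right, reInner_smul_left, reInner_smul_right, reInner_comm v c, reInner_comm z c,
    reInner_comm z v]
  ring

/-- Every real linear functional is a real inner product. -/
theorem exists_reInner_eq (l : CVec n →L[ℝ] ℝ) : ∃ u : CVec n, ∀ z, reInner u z = l z := by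
  refine ⟨(InnerProductSpace.toDual ℂ (CVec n)).symm (StrongDual.extendRCLike (𝕜 := ℂ) l),
    fun z => ?_⟩
  rw [reInner, InnerProductSpace.toDual_symm_apply]
  exact StrongDual.re_extendRCLike_apply (𝕜 := ℂ) l z

/-! ### Subgradients -/

/-- A hyperplane separating `(x, q x)` from the open strict epigraph is not vertical, as its last
coefficient is negative; dividing by that coefficient gives a subgradient. -/
theorem subdifferential_nonempty {q : CVec n → ℝ} (hq : ConvexOn ℝ univ q) (x : CVec n) :
    (subdifferential q x).Nonempty := by
  have hqc : Continuous q := continuousOn_univ.1 (hq.continuousOn isOpen_univ)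
  have hopen : IsOpen {p : CVec n × ℝ | p.1 ∈ univ ∧ q p.1 < p.2} := by
    simpa using isOpen_lt (hqc.comp continuous_fst) continuous_snd
  obtain ⟨L, hL⟩ := geometric_hahn_banach_open_point hq.convex_strict_epigraph hopen
    (x := (x, q x)) (by simp)
  have hsplit : ∀ z s, L (z, s) = L (z, 0) + s * L (0, 1) := fun z s => by
    rw [← smul_eq_mul, ← map_smul, ← map_add]; simp
  have hneg : L (0, 1) < 0 := by
    have h := hL (x, q x + 1) (by simp)
    rw [hsplit, hsplit x (q x)] at h
    linarith
  obtain ⟨u, hu⟩ := exists_reInner_eq ((-L (0, 1))⁻¹ • L.comp (.inl ℝ (CVec n) ℝ))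
  refine ⟨u, fun z => ?_⟩
  have key : L (z, 0) - L (x, 0) ≤ -L (0, 1) * (q z - q x) := by
    refine le_of_forall_pos_le_add fun η hη => ?_
    have h := hL (z, q z + η / -L (0, 1)) (by simpa using div_pos hη (neg_pos.2 hneg))
    rw [hsplit, hsplit x] at h
    have : η / -L (0, 1) * L (0, 1) = -η := by
      rw [div_neg, neg_mul, div_mul_cancel₀ _ hneg.ne]
    linarith
  rw [hu, ← inv_mul_le_iff₀ (neg_pos.2 hneg)] at *
  have : L (z - x, 0) = L (z, 0) - L (x, 0) := by rw [← map_sub]; simp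
  simp only [smul_apply, ContinuousLinearMap.comp_apply,
    ContinuousLinearMap.inl_apply, smul_eq_mul, this]
  linarith

/-- The descent inequality of a Hölder smooth function. -/
theorem IsHolderSmooth.le_add {q : CVec n → ℝ} {Q : Set (CVec n)} {ν M : ℝ}
    (hq : IsHolderSmooth q Q ν M) (hQ : Convex ℝ Q) (hν : 0 ≤ ν) {x y u : CVec n}
    (hx : x ∈ Q) (hy : y ∈ Q) (hu : u ∈ subdifferential q x) :
    q y ≤ q x + reInner u (y - x) + M / (1 + ν) * ‖y - x‖ ^ (1 + ν) := by
  have hqc : Continuous q := continuousOn_univ.1 (hq.convex.continuousOn isOpen_univ)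
  set d := y - x with hd
  set c := M * ‖d‖ ^ (1 + ν) with hc
  have hν1 : 0 < 1 + ν := by linarith
  have hmem : ∀ t ∈ Icc (0 : ℝ) 1, x + t • d ∈ Q := fun t ht => by
    simpa [hd] using hQ.add_smul_sub_mem hx hy ht
  have hderiv : ∀ t : ℝ, HasDerivAt
      (fun t : ℝ => q x + t * reInner u d + c / (1 + ν) * t ^ (1 + ν))
      (reInner u d + c * t ^ ν) t := fun t => by
    have h := ((hasDerivAt_id t).mul_const (reInner u d)).const_add (q x)
    have h2 := (Real.hasDerivAt_rpow_const (x := t) (p := 1 + ν) (Or.inr (by linarith))).const_mul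
      (c / (1 + ν))
    convert! h.add h2 using 1
    rw [add_sub_cancel_left]
    field_simp
  -- `q` need not be differentiable along the segment, but a bound on its right slopes by the
  -- derivative of `B` suffices for the comparison.
  have main := image_le_of_liminf_slope_right_le_deriv_boundary (a := 0) (b := 1)
    (f := fun t : ℝ => q (x + t • d))
    (B := fun t : ℝ => q x + t * reInner u d + c / (1 + ν) * t ^ (1 + ν))
    (B' := fun t : ℝ => reInner u d + c * t ^ ν) (by fun_prop)
    (by simp [Real.zero_rpow hν1.ne'])
    (fun t _ => (hderiv t).continuousAt.continuousWithinAt)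
    (fun t _ => (hderiv t).hasDerivWithinAt)
    (fun t ht r hr => ?_) (right_mem_Icc.2 zero_le_one)
  · simp only [one_smul, one_mul, Real.one_rpow, mul_one] at main
    rw [hd, add_sub_cancel, ← hd, hc] at main
    linarith [mul_div_right_comm M (‖d‖ ^ (1 + ν)) (1 + ν)]
  · have hcont : ContinuousAt (fun s : ℝ => reInner u d + c * s ^ ν) t :=
      ((Real.continuousAt_rpow_const t ν (Or.inr hν)).const_mul c).const_add _
    have hev : ∀ᶠ s in 𝓝[>] t, reInner u d + c * s ^ ν < r :=
      (hcont.eventually_lt_const hr).filter_mono nhdsWithin_le_nhds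
    have hlt : ∀ᶠ s in 𝓝[>] t, s ∈ Ioo t 1 := Ioo_mem_nhdsGT ht.2
    refine (hev.and hlt).frequently.mono fun s hs => lt_of_le_of_lt ?_ hs.1
    have hs0 : 0 ≤ s := ht.1.trans hs.2.1.le
    have hst : 0 < s - t := sub_pos.2 hs.2.1
    have hsQ := hmem s ⟨hs0, hs.2.2.le⟩
    -- By convexity, a subgradient at the right endpoint bounds the slope over `[t, s]` from above;
    -- the Hölder condition then compares it with `u`.
    obtain ⟨w, hw⟩ := subdifferential_nonempty hq.convex (x + s • d)
    have h1 := hw (x + t • d)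
    have h2 : x + t • d - (x + s • d) = (t - s) • d := by module
    rw [h2, reInner_smul_right] at h1
    have h3 : reInner w d - reInner u d ≤ c * s ^ ν := by
      rw [← reInner_sub_left]
      refine (reInner_le_norm_mul_norm _ _).trans ?_
      have h4 := hq.holder _ hsQ _ hx _ hw _ hu
      rw [add_sub_cancel_left, norm_smul, Real.norm_of_nonneg hs0,
        Real.mul_rpow hs0 (norm_nonneg d)] at h4
      refine (mul_le_mul_of_nonneg_right h4 (norm_nonneg d)).trans (le_of_eq ?_)
      rw [hc, Real.rpow_add' (norm_nonneg d) hν1.ne', Real.rpow_one]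
      ring
    rw [slope_def_field, div_le_iff₀ hst]
    nlinarith

/-! ### Proximal points -/

/-- A closed convex function with finite values on a closed set has a proximal point. -/
theorem exists_prox_real (hQne : Q.Nonempty) (hQcl : IsClosed Q) {h : CVec n → ℝ}
    (hconv : ConvexOn ℝ Q h) (hlsc : LowerSemicontinuousOn h Q) (c : CVec n) :
    ∃ z ∈ Q, ∀ w ∈ Q, h z + ‖c - z‖ ^ 2 / 2 ≤ h w + ‖c - w‖ ^ 2 / 2 := by
  obtain ⟨w₀, hw₀⟩ := hQne
  obtain ⟨l, b, hlb, -⟩ := hconv.exists_affine_le_of_lt (𝕜 := ℝ) hw₀ (sub_one_lt (h w₀)) hQcl hlsc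
  have hmin : ∀ z ∈ Q, l c + b - ‖l‖ * ‖c - z‖ ≤ h z := fun z hz => by
    have h1 : l z + b ≤ h z := hlb ⟨z, hz⟩
    have h2 := (le_abs_self _).trans (l.le_opNorm (c - z))
    rw [map_sub] at h2
    linarith
  set V := h w₀ + ‖c - w₀‖ ^ 2 / 2 with hV
  -- Beyond radius `R` the term `ρ²/2` exceeds the linear loss `‖l‖ ρ` by more than `|V - (l c +
  -- b)|`, because `R/2 - ‖l‖ ≥ 1`.
  set R := 2 * (‖l‖ + 1) + |V - (l c + b)| + 1 with hR
  have hfar : ∀ z ∈ Q, R < ‖c - z‖ → V < h z + ‖c - z‖ ^ 2 / 2 := fun z hz hzR => by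
    have h1 := hmin z hz
    have h2 := le_abs_self (V - (l c + b))
    have h3 := norm_nonneg l
    have h4 := abs_nonneg (V - (l c + b))
    nlinarith
  have hcomp : IsCompact (Q ∩ Metric.closedBall c R) :=
    (isCompact_closedBall c R).inter_left hQcl
  have hball : ∀ z, z ∈ Metric.closedBall c R ↔ ‖c - z‖ ≤ R := fun z => by
    rw [mem_closedBall_iff_norm']
  have hne : (Q ∩ Metric.closedBall c R).Nonempty :=
    ⟨w₀, hw₀, (hball _).2 (not_lt.1 fun hlt => (hfar w₀ hw₀ hlt).ne hV)⟩
  have hl : LowerSemicontinuousOn (fun z => h z + ‖c - z‖ ^ 2 / 2) (Q ∩ Metric.closedBall c R) :=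
    (hlsc.mono inter_subset_left).add
      (Continuous.continuousOn (by fun_prop)).lowerSemicontinuousOn
  obtain ⟨z, hz, hzmin⟩ := hl.exists_isMinOn hne hcomp
  refine ⟨z, hz.1, fun w hw => ?_⟩
  by_cases hwR : ‖c - w‖ ≤ R
  · exact hzmin ⟨hw, (hball _).2 hwR⟩
  · have h1 : h z + ‖c - z‖ ^ 2 / 2 ≤ V := by
      by_cases h0 : ‖c - w₀‖ ≤ R
      · exact hzmin ⟨hw₀, (hball _).2 h0⟩
      · exact absurd hV (hfar w₀ hw₀ (not_le.1 h0)).ne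
    exact h1.trans (hfar w hw (not_le.1 hwR)).le

/-- The prox objective grows quadratically around the proximal point. -/
theorem prox_real_add_le {h : CVec n → ℝ} (hconv : ConvexOn ℝ Q h) {c v : CVec n} (hv : v ∈ Q)
    (hmin : ∀ w ∈ Q, h v + ‖c - v‖ ^ 2 / 2 ≤ h w + ‖c - w‖ ^ 2 / 2) {z : CVec n} (hz : z ∈ Q) :
    h v + ‖c - v‖ ^ 2 / 2 + ‖z - v‖ ^ 2 / 2 ≤ h z + ‖c - z‖ ^ 2 / 2 := by
  -- Minimality is tested at the point `(1 - t) v + t z`; dividing by `t` and letting `t → 0` leaves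
  -- the full quadratic term.
  have key : ∀ t : ℝ, 0 < t → t ≤ 1 →
      h v + ‖c - v‖ ^ 2 / 2 + (1 - t) * ‖z - v‖ ^ 2 / 2 ≤ h z + ‖c - z‖ ^ 2 / 2 := by
    intro t ht ht1
    have h1 := hmin _ (hconv.1 hv hz (sub_nonneg.2 ht1) ht.le (sub_add_cancel 1 t))
    have h2 := hconv.2 hv hz (sub_nonneg.2 ht1) ht.le (sub_add_cancel 1 t)
    rw [norm_sq_segment] at h1
    simp only [smul_eq_mul] at h2
    refine le_of_mul_le_mul_left ?_ ht
    linarith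
  have hlim : Tendsto (fun t : ℝ => h v + ‖c - v‖ ^ 2 / 2 + (1 - t) * ‖z - v‖ ^ 2 / 2) (𝓝[>] 0)
      (𝓝 (h v + ‖c - v‖ ^ 2 / 2 + (1 - 0) * ‖z - v‖ ^ 2 / 2)) :=
    (Continuous.tendsto (by fun_prop) 0).mono_left nhdsWithin_le_nhds
  have := le_of_tendsto hlim (mem_of_superset (Ioc_mem_nhdsGT one_pos) fun t ht => key t ht.1 ht.2)
  simpa using this

/-- Proximal points of an extended-valued function that is finite on `Q`. -/
theorem isProx_iff_of_eq_coe {φ : CVec n → EReal} {h : CVec n → ℝ}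
    (hφ : ∀ z ∈ Q, φ z = (h z : EReal)) {c z : CVec n} :
    IsProx φ Q c z ↔ z ∈ Q ∧ ∀ w ∈ Q, h z + ‖c - z‖ ^ 2 / 2 ≤ h w + ‖c - w‖ ^ 2 / 2 := by
  refine and_congr_right fun hz => forall₂_congr fun w hw => ?_
  rw [hφ z hz, hφ w hw]
  norm_cast

/-! ### The nonsmooth part on its domain -/

section Nonsmooth

theorem IsProperClosedConvex.coe_toReal (hg : IsProperClosedConvex g)
    (hQg : Q ⊆ effectiveDomain g) {z : CVec n} (hz : z ∈ Q) : ((g z).toReal : EReal) = g z :=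
  EReal.coe_toReal (hQg hz).ne (hg.ne_bot z)

theorem IsProperClosedConvex.toReal_le_iff (hg : IsProperClosedConvex g)
    (hQg : Q ⊆ effectiveDomain g) {z : CVec n} (hz : z ∈ Q) {s : ℝ} :
    (g z).toReal ≤ s ↔ g z ≤ s := by
  rw [← EReal.coe_le_coe_iff, hg.coe_toReal hQg hz]

theorem IsProperClosedConvex.convexOn_toReal (hg : IsProperClosedConvex g)
    (hQg : Q ⊆ effectiveDomain g) (hQ : Convex ℝ Q) : ConvexOn ℝ Q fun z => (g z).toReal := by
  refine ⟨hQ, fun x hx y hy a b ha hb hab => ?_⟩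
  rw [hg.toReal_le_iff hQg (hQ hx hy ha hb hab)]
  have hmem : ∀ z ∈ Q, (z, (g z).toReal) ∈ {p : CVec n × ℝ | g p.1 ≤ (p.2 : EReal)} :=
    fun z hz => (hg.coe_toReal hQg hz).ge
  exact hg.convex_epigraph (hmem x hx) (hmem y hy) ha hb hab

theorem IsProperClosedConvex.lowerSemicontinuousOn_toReal (hg : IsProperClosedConvex g)
    (hQg : Q ⊆ effectiveDomain g) (hQ : IsClosed Q) :
    LowerSemicontinuousOn (fun z => (g z).toReal) Q := by
  rw [lowerSemicontinuousOn_iff_isClosed_epigraph hQ]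
  convert! (hQ.preimage continuous_fst).inter hg.closed_epigraph using 1
  ext p
  exact and_congr_right fun hp => hg.toReal_le_iff hQg hp

/-- `φ` coincides on `Q` with `A g` plus a real affine function. -/
def IsCompositeOn (g : CVec n → EReal) (Q : Set (CVec n)) (A : ℝ) (φ : CVec n → EReal) : Prop :=
  ∃ (w : CVec n) (b : ℝ), ∀ z ∈ Q, φ z = ((A * (g z).toReal + reInner w z + b : ℝ) : EReal)

theorem IsProperClosedConvex.convexOn_composite (hg : IsProperClosedConvex g)
    (hQg : Q ⊆ effectiveDomain g) (hQ : Convex ℝ Q) {A : ℝ} (hA : 0 ≤ A) (w : CVec n) (b : ℝ) :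
    ConvexOn ℝ Q fun z => A * (g z).toReal + reInner w z + b := by
  refine ⟨hQ, fun x hx y hy s t hs ht hst => ?_⟩
  have h := mul_le_mul_of_nonneg_left ((hg.convexOn_toReal hQg hQ).2 hx hy hs ht hst) hA
  simp only [smul_eq_mul, reInner_add_right, reInner_smul_right] at h ⊢
  have hb : b = s * b + t * b := by rw [← add_mul, hst, one_mul]
  linarith

theorem IsProperClosedConvex.exists_isProx (hg : IsProperClosedConvex g)
    (hQg : Q ⊆ effectiveDomain g) (hQne : Q.Nonempty) (hQcl : IsClosed Q) (hQ : Convex ℝ Q)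
    {A : ℝ} (hA : 0 ≤ A) {φ : CVec n → EReal} (hφ : IsCompositeOn g Q A φ) (c : CVec n) :
    ∃ z, IsProx φ Q c z := by
  obtain ⟨w, b, hφ⟩ := hφ
  have hlsc : LowerSemicontinuousOn (fun z => A * (g z).toReal + (reInner w z + b)) Q :=
    ((continuous_const_mul A).comp_lowerSemicontinuousOn
      (hg.lowerSemicontinuousOn_toReal hQg hQcl) (monotone_mul_left_of_nonneg hA)).add
      ((continuous_reInner w).add continuous_const).continuousOn.lowerSemicontinuousOn
  simp only [← add_assoc] at hlsc
  obtain ⟨z, hz, hmin⟩ :=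
    exists_prox_real hQne hQcl (hg.convexOn_composite hQg hQ hA w b) hlsc c
  exact ⟨z, (isProx_iff_of_eq_coe hφ).2 ⟨hz, hmin⟩⟩

theorem IsProperClosedConvex.coe_linear_model (hg : IsProperClosedConvex g)
    (hQg : Q ⊆ effectiveDomain g) (a : ℝ) (u : CVec n) {z : CVec n} (hz : z ∈ Q) :
    (a : EReal) * ((reInner u z : EReal) + g z) =
      ((a * (reInner u z + (g z).toReal) : ℝ) : EReal) := by
  rw [← hg.coe_toReal hQg hz]
  norm_cast

theorem IsProperClosedConvex.isCompositeOn_linear_model (hg : IsProperClosedConvex g)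
    (hQg : Q ⊆ effectiveDomain g) (a : ℝ) (u : CVec n) :
    IsCompositeOn g Q a fun z => (a : EReal) * ((reInner u z : EReal) + g z) := by
  refine ⟨a • u, 0, fun z hz => ?_⟩
  refine (hg.coe_linear_model hQg a u hz).trans ?_
  rw [reInner_smul_left]
  congr 1
  ring

theorem IsProperClosedConvex.objective_eq (hg : IsProperClosedConvex g)
    (hQg : Q ⊆ effectiveDomain g) (q : CVec n → ℝ) {z : CVec n} (hz : z ∈ Q) :
    objective q g z = ((q z + (g z).toReal : ℝ) : EReal) := by
  rw [objective, ← hg.coe_toReal hQg hz]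
  norm_cast

theorem optimalValue_eq_of_mem_minimizers {f : CVec n → EReal} {x : CVec n}
    (hx : x ∈ minimizers f Q) : optimalValue f Q = f x := hx.2.symm

/-- Closedness makes the distance from `x₀` attained at an actual minimizer. The set is the part of
`Q` that `z ↦ (z, f(x) - q(z))` sends into the epigraph of `g`. -/
theorem IsProperClosedConvex.isClosed_minimizers (hg : IsProperClosedConvex g)
    (hQg : Q ⊆ effectiveDomain g) (hQcl : IsClosed Q) {q : CVec n → ℝ} (hq : Continuous q)
    (hne : (minimizers (objective q g) Q).Nonempty) :
    IsClosed (minimizers (objective q g) Q) := by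
  obtain ⟨x, hx⟩ := hne
  have hcont : Continuous fun z : CVec n => (z, q x + (g x).toReal - q z) := by fun_prop
  convert! hQcl.inter (hg.closed_epigraph.preimage hcont) using 1
  ext z
  refine and_congr_right fun hz => ?_
  have h1 : objective q g z = optimalValue (objective q g) Q ↔
      objective q g z ≤ objective q g x := by
    rw [← optimalValue_eq_of_mem_minimizers hx]
    exact ⟨le_of_eq, fun h => h.antisymm (iInf₂_le z hz)⟩
  rw [h1, hg.objective_eq hQg q hz, hg.objective_eq hQg q hx.1, EReal.coe_le_coe_iff]
  simp only [mem_preimage, mem_ofPred_eq]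
  rw [← hg.toReal_le_iff hQg hz]
  constructor <;> intro h <;> linarith

end Nonsmooth

/-! ### The step size equation -/

theorem exists_stepSize {A S : ℝ} (hA : 0 ≤ A) (hS : 0 < S) :
    ∃ a : ℝ, 0 < a ∧ a ^ 2 = 1 / S * (A + a) := by
  have h0 : (0 : ℝ) ≤ 1 + 4 * S * A := by positivity
  have hsq := Real.sq_sqrt h0
  refine ⟨(1 + √(1 + 4 * S * A)) / (2 * S), by positivity, ?_⟩
  field_simp
  linear_combination hsq

/-- The equation reads `S = (A + a)/a²`, whose right side decreases in `a > 0`. -/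
theorem stepSize_anti {A S S' a a' : ℝ} (hA : 0 ≤ A) (hS : 0 < S) (hSS' : S ≤ S') (ha : 0 < a)
    (ha' : 0 < a') (h : a ^ 2 = 1 / S * (A + a)) (h' : a' ^ 2 = 1 / S' * (A + a')) : a' ≤ a := by
  have hS' : 0 < S' := hS.trans_le hSS'
  have e : S * a ^ 2 = A + a := by rw [h]; field_simp
  have e' : S' * a' ^ 2 = A + a' := by rw [h']; field_simp
  by_contra! hlt
  have h1 : S * a' ^ 2 ≤ A + a' := e' ▸ mul_le_mul_of_nonneg_right hSS' (sq_nonneg a')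
  have h2 : S * a ^ 2 * a' ^ 2 ≤ (A + a') * a ^ 2 := by nlinarith [sq_nonneg a]
  rw [e] at h2
  have h3 : 0 < a * a' := mul_pos ha ha'
  nlinarith [mul_pos h3 (sub_pos.2 hlt), mul_nonneg hA (sub_pos.2 hlt).le,
    mul_nonneg hA (mul_nonneg (sub_pos.2 hlt).le (add_pos ha ha').le)]

/-! ### Trials -/

section Trial

variable {v y : CVec n} {A L : ℝ} {i : ℕ} {t : Trial n}

theorem IsTrial.A_pos (ht : IsTrial Q q g v y A L i t) (hA : 0 ≤ A) : 0 < t.A := by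
  rw [ht.A_eq]
  linarith [ht.a_pos]

theorem IsTrial.τ_pos (ht : IsTrial Q q g v y A L i t) (hA : 0 ≤ A) : 0 < t.τ := by
  rw [ht.τ_eq]
  exact div_pos ht.a_pos (ht.A_pos hA)

theorem IsTrial.τ_le_one (ht : IsTrial Q q g v y A L i t) (hA : 0 ≤ A) : t.τ ≤ 1 := by
  rw [ht.τ_eq, div_le_one (ht.A_pos hA), ht.A_eq]
  linarith

theorem IsTrial.τ_mul_A (ht : IsTrial Q q g v y A L i t) (hA : 0 ≤ A) : t.τ * t.A = t.a := by
  rw [ht.τ_eq, div_mul_cancel₀ _ (ht.A_pos hA).ne']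

theorem IsTrial.mul_a_sq (ht : IsTrial Q q g v y A L i t) (hL : 0 < L) :
    2 ^ i * L * t.a ^ 2 = t.A := by
  rw [ht.a_eq, ht.A_eq]
  field_simp

/-- This normalization makes the quadratic term of the acceptance test, multiplied by `t.A`, equal
to the prox term `‖xhat - v‖²/2`. -/
theorem IsTrial.mul_τ_sq (ht : IsTrial Q q g v y A L i t) (hA : 0 ≤ A) (hL : 0 < L) :
    2 ^ i * L * t.A * t.τ ^ 2 = 1 := by
  have h1 := ht.mul_a_sq hL
  rw [← ht.τ_mul_A hA] at h1
  refine mul_right_cancel₀ (ht.A_pos hA).ne' ?_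
  linear_combination h1

theorem IsTrial.log_a (ht : IsTrial Q q g v y A L i t) (hL : 0 < L) :
    Real.log (2 ^ i * L) + 2 * Real.log t.a = Real.log t.A := by
  have h := congrArg Real.log (ht.mul_a_sq hL)
  have := ht.a_pos
  rwa [Real.log_mul (by positivity) (by positivity), Real.log_pow, Nat.cast_ofNat] at h

theorem IsTrial.log_τ (ht : IsTrial Q q g v y A L i t) (hA : 0 ≤ A) :
    Real.log t.τ = Real.log t.a - Real.log t.A := by
  rw [ht.τ_eq, Real.log_div ht.a_pos.ne' (ht.A_pos hA).ne']

theorem IsTrial.a_anti {j : ℕ} {s : Trial n} (ht : IsTrial Q q g v y A L i t)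
    (hs : IsTrial Q q g v y A L j s) (hA : 0 ≤ A) (hL : 0 < L) (hij : i ≤ j) : s.a ≤ t.a :=
  stepSize_anti hA (by positivity)
    (mul_le_mul_of_nonneg_right (pow_le_pow_right₀ one_le_two hij) hL.le)
    ht.a_pos hs.a_pos ht.a_eq hs.a_eq

theorem IsTrial.τ_anti {j : ℕ} {s : Trial n} (ht : IsTrial Q q g v y A L i t)
    (hs : IsTrial Q q g v y A L j s) (hA : 0 ≤ A) (hL : 0 < L) (hij : i ≤ j) : s.τ ≤ t.τ := by
  have h := ht.a_anti hs hA hL hij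
  rw [ht.τ_eq, hs.τ_eq, div_le_div_iff₀ (hs.A_pos hA) (ht.A_pos hA), ht.A_eq, hs.A_eq]
  nlinarith

theorem IsTrial.x_mem (ht : IsTrial Q q g v y A L i t) (hQ : Convex ℝ Q) (hA : 0 ≤ A)
    (hv : v ∈ Q) (hy : y ∈ Q) : t.x ∈ Q := by
  rw [ht.x_eq]
  exact hQ hv hy (ht.τ_pos hA).le (sub_nonneg.2 (ht.τ_le_one hA)) (by ring)

theorem IsTrial.y_mem (ht : IsTrial Q q g v y A L i t) (hQ : Convex ℝ Q) (hA : 0 ≤ A)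
    (hy : y ∈ Q) : t.y ∈ Q := by
  rw [ht.y_eq]
  exact hQ ht.xhat_prox.1 hy (ht.τ_pos hA).le (sub_nonneg.2 (ht.τ_le_one hA)) (by ring)

theorem exists_isTrial (hg : IsProperClosedConvex g) (hQg : Q ⊆ effectiveDomain g)
    (hQcl : IsClosed Q) (hQ : Convex ℝ Q) (hv : v ∈ Q) (hy : y ∈ Q) (hA : 0 ≤ A) (hL : 0 < L)
    (i : ℕ) (G : CVec n → CVec n) (hG : ∀ z ∈ Q, G z ∈ subdifferential q z) :
    ∃ t, IsTrial Q q g v y A L i t ∧ t.u = G t.x := by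
  obtain ⟨a, ha, haeq⟩ := exists_stepSize hA (show 0 < 2 ^ i * L by positivity)
  set τ := a / (A + a) with hτ
  have hAa : 0 < A + a := by linarith
  have hτ0 : 0 ≤ τ := by positivity
  have hτ1 : τ ≤ 1 := by rw [hτ, div_le_one hAa]; linarith
  set x := τ • v + (1 - τ) • y
  have hx : x ∈ Q := hQ hv hy hτ0 (sub_nonneg.2 hτ1) (by ring)
  obtain ⟨z, hz⟩ := hg.exists_isProx hQg ⟨v, hv⟩ hQcl hQ ha.le
    (hg.isCompositeOn_linear_model hQg a (G x)) v
  exact ⟨⟨a, A + a, τ, x, G x, z, τ • z + (1 - τ) • y⟩,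
    ⟨ha, haeq, rfl, rfl, rfl, hG x hx, hz, rfl⟩, rfl⟩

end Trial

/-! ### The line search -/

/-- The Hölder term is dominated by a quadratic one with a large enough coefficient. -/
theorem rpow_le_quadratic {ν M S δ s : ℝ} (hν0 : 0 ≤ ν) (hν1 : ν ≤ 1) (hM : 0 < M) (hS : 0 < S)
    (hδ : 0 < δ) (hs : 0 ≤ s)
    (h : Real.log M ≤ (1 + ν) / 2 * Real.log S + (1 - ν) / 2 * Real.log δ) :
    M / (1 + ν) * s ^ (1 + ν) ≤ S / 2 * s ^ 2 + δ / 2 := by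
  have hMle : M ≤ S ^ ((1 + ν) / 2) * δ ^ ((1 - ν) / 2) := by
    rw [← Real.log_le_log_iff hM (by positivity), Real.log_mul (by positivity) (by positivity),
      Real.log_rpow hS, Real.log_rpow hδ]
    exact h
  -- These weights turn `S s²` into `s^(1+ν)`. After division by `1 + ν`, the weight of `δ` is
  -- `(1-ν)/(2(1+ν)) ≤ 1/2`.
  have hyoung := Real.geom_mean_le_arith_mean2_weighted (w₁ := (1 + ν) / 2) (w₂ := (1 - ν) / 2)
    (p₁ := S * s ^ 2) (p₂ := δ) (by linarith) (by linarith) (by positivity) hδ.le (by ring)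
  have hpow : (S * s ^ 2) ^ ((1 + ν) / 2) = S ^ ((1 + ν) / 2) * s ^ (1 + ν) := by
    rw [Real.mul_rpow hS.le (sq_nonneg s), ← Real.rpow_natCast_mul hs]
    congr 2
    push_cast
    ring
  have h1 : M * s ^ (1 + ν) ≤ (1 + ν) / 2 * (S * s ^ 2) + (1 - ν) / 2 * δ := by
    refine le_trans ?_ hyoung
    rw [hpow, mul_right_comm]
    exact mul_le_mul_of_nonneg_right hMle (by positivity)
  rw [div_mul_eq_mul_div, div_le_iff₀ (by linarith)]
  nlinarith [mul_nonneg hν0 hδ.le]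

/-- Passes of the line search with a large enough quadratic coefficient are accepted. -/
theorem IsHolderSmooth.accepted {ν M : ℝ} (hq : IsHolderSmooth q Q ν M) (hQ : Convex ℝ Q)
    (hν0 : 0 ≤ ν) (hν1 : ν ≤ 1) (hM : 0 < M) {v y : CVec n} {A L ε : ℝ} {i : ℕ} {t : Trial n}
    (hv : v ∈ Q) (hy : y ∈ Q) (hA : 0 ≤ A) (hL : 0 < L) (hε : 0 < ε)
    (ht : IsTrial Q q g v y A L i t)
    (h : Real.log M ≤
      (1 + ν) / 2 * Real.log (2 ^ i * L) + (1 - ν) / 2 * (Real.log ε + Real.log t.τ)) :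
    Accepted q ε L i t := by
  have hτ := ht.τ_pos hA
  have h1 := hq.le_add hQ hν0 (ht.x_mem hQ hA hv hy) (ht.y_mem hQ hA hy) ht.u_mem
  rw [← Real.log_mul hε.ne' hτ.ne'] at h
  have h2 := rpow_le_quadratic hν0 hν1 hM (by positivity) (mul_pos hε hτ)
    (norm_nonneg (t.y - t.x)) h
  unfold Accepted
  linarith

/-- The tolerance `ε τ` shrinks as `i` grows, but only like `S^(-1/2)`, since `τ = (S A)^(-1/2)` and
the trial weights `A` stay below that of pass `0`. In the acceptance condition `S` keeps the net
exponent `(1+3ν)/4 > 0`. -/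
theorem IsHolderSmooth.exists_accepted {ν M : ℝ} (hq : IsHolderSmooth q Q ν M) (hQ : Convex ℝ Q)
    (hν0 : 0 ≤ ν) (hν1 : ν ≤ 1) (hM : 0 < M) {v y : CVec n} {A L ε : ℝ} {t : ℕ → Trial n}
    (hv : v ∈ Q) (hy : y ∈ Q) (hA : 0 ≤ A) (hL : 0 < L) (hε : 0 < ε)
    (ht : ∀ i, IsTrial Q q g v y A L i (t i)) : ∃ i, Accepted q ε L i (t i) := by
  set K := Real.log M - (1 - ν) / 2 * Real.log ε + (1 - ν) / 4 * Real.log (t 0).A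
    - (1 + 3 * ν) / 4 * Real.log L with hK
  obtain ⟨i, hi⟩ := exists_nat_ge (K / ((1 + 3 * ν) / 4 * Real.log 2))
  have hlog2 : 0 < Real.log 2 := Real.log_pos one_lt_two
  rw [div_le_iff₀ (by positivity)] at hi
  refine ⟨i, hq.accepted hQ hν0 hν1 hM hv hy hA hL hε (ht i) ?_⟩
  have h1 : Real.log (t i).A ≤ Real.log (t 0).A := by
    refine Real.log_le_log ((ht i).A_pos hA) ?_
    rw [(ht i).A_eq, (ht 0).A_eq]
    linarith [(ht 0).a_anti (ht i) hA hL (Nat.zero_le i)]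
  have h2 := (ht i).log_a hL
  have h3 := (ht i).log_τ hA
  have h4 : Real.log (2 ^ i * L) = i * Real.log 2 + Real.log L := by
    rw [Real.log_mul (by positivity) hL.ne', Real.log_pow]
  have h5 := mul_le_mul_of_nonneg_left h1 (show 0 ≤ (1 - ν) / 4 by linarith)
  have h6 : Real.log (t i).τ = -(Real.log (2 ^ i * L) + Real.log (t i).A) / 2 := by linarith
  rw [h6, h4]
  linarith

/-! ### The estimating sequence -/

theorem IsCompositeOn.coe_toReal {A : ℝ} {φ : CVec n → EReal} (hφ : IsCompositeOn g Q A φ)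
    {z : CVec n} (hz : z ∈ Q) : φ z = ((φ z).toReal : EReal) := by
  obtain ⟨w, b, hφ⟩ := hφ
  rw [hφ z hz, EReal.toReal_coe]

theorem IsCompositeOn.convexOn_toReal (hg : IsProperClosedConvex g)
    (hQg : Q ⊆ effectiveDomain g) (hQ : Convex ℝ Q) {A : ℝ} (hA : 0 ≤ A) {φ : CVec n → EReal}
    (hφ : IsCompositeOn g Q A φ) : ConvexOn ℝ Q fun z => (φ z).toReal := by
  obtain ⟨w, b, hφ⟩ := hφ
  refine (hg.convexOn_composite hQg hQ hA w b).congr fun z hz => ?_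
  rw [hφ z hz, EReal.toReal_coe]

/-- Adding a weighted linearization to a composite function. -/
theorem IsCompositeOn.add_model (hg : IsProperClosedConvex g) (hQg : Q ⊆ effectiveDomain g)
    {A a c : ℝ} {φ ψ : CVec n → EReal} (hφ : IsCompositeOn g Q A φ) {u x : CVec n}
    (hψ : ∀ z, ψ z = φ z + (a : EReal) * (((c + reInner u (z - x) : ℝ) : EReal) + g z)) :
    IsCompositeOn g Q (A + a) ψ ∧ ∀ z ∈ Q,
      (ψ z).toReal = (φ z).toReal + a * (c + reInner u (z - x) + (g z).toReal) := by
  have key : ∀ z ∈ Q,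
      ψ z = (((φ z).toReal + a * (c + reInner u (z - x) + (g z).toReal) : ℝ) : EReal) :=
    fun z hz => by
      rw [hψ, hφ.coe_toReal hz, ← hg.coe_toReal hQg hz]
      norm_cast
  refine ⟨?_, fun z hz => by rw [key z hz, EReal.toReal_coe]⟩
  obtain ⟨w, b, hφ⟩ := hφ
  refine ⟨w + a • u, b + a * (c - reInner u x), fun z hz => ?_⟩
  rw [key z hz, hφ z hz, EReal.toReal_coe, reInner_add_left, reInner_smul_left, reInner_sub_right]
  congr 1
  ring

/-- One step of the estimating sequence. -/
theorem IsTrial.estimate (hg : IsProperClosedConvex g) (hQg : Q ⊆ effectiveDomain g)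
    (hQ : Convex ℝ Q) {v y x₀ : CVec n} {A L ε : ℝ} {i : ℕ} {t : Trial n} {φ : CVec n → EReal}
    (ht : IsTrial Q q g v y A L i t) (hacc : Accepted q ε L i t) (hA : 0 ≤ A) (hL : 0 < L)
    (hy : y ∈ Q) (hφ : IsCompositeOn g Q A φ) (hv : IsProx φ Q x₀ v)
    (hest : ∀ z ∈ Q, A * (q y + (g y).toReal - ε / 2) ≤ (φ z).toReal + ‖x₀ - z‖ ^ 2 / 2)
    {z : CVec n} (hz : z ∈ Q) :
    t.A * (q t.y + (g t.y).toReal - ε / 2) ≤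
      (φ z).toReal + t.a * (q t.x + reInner t.u (z - t.x) + (g z).toReal)
        + ‖x₀ - z‖ ^ 2 / 2 := by
  have hτ0 := ht.τ_pos hA
  have hτ1 := ht.τ_le_one hA
  have hApos := ht.A_pos hA
  obtain ⟨hvQ, hvmin⟩ := (isProx_iff_of_eq_coe fun z hz => hφ.coe_toReal hz).1 hv
  -- The gain `‖z - v‖²/2` from strong convexity cancels the same term on the right of the prox
  -- inequality for `xhat`.
  have hstrong := prox_real_add_le (hφ.convexOn_toReal hg hQg hQ hA) hvQ hvmin hz
  have hEv := hest v hvQ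
  obtain ⟨hxQ, hxmin⟩ :=
    (isProx_iff_of_eq_coe fun z hz => hg.coe_linear_model hQg t.a t.u hz).1 ht.xhat_prox
  have hprox := hxmin z hz
  rw [norm_sub_rev v z, norm_sub_rev v t.xhat] at hprox
  -- Linearizing at `t.x` bounds the old value `A * q y` from below, so that old and new
  -- contributions combine at the same point.
  have hsub := ht.u_mem y
  have hgy : (g t.y).toReal ≤ t.τ * (g t.xhat).toReal + (1 - t.τ) * (g y).toReal := by
    have h := (hg.convexOn_toReal hQg hQ).2 hxQ hy hτ0.le (sub_nonneg.2 hτ1) (by ring)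
    rwa [← ht.y_eq] at h
  have hdiff : t.y - t.x = t.τ • (t.xhat - v) := by
    rw [ht.y_eq, ht.x_eq]
    module
  have hinner : reInner t.u (t.y - t.x) =
      t.τ * reInner t.u (t.xhat - t.x) + (1 - t.τ) * reInner t.u (y - t.x) := by
    rw [← reInner_smul_right, ← reInner_smul_right, ← reInner_add_right]
    congr 1
    rw [ht.y_eq]
    module
  unfold Accepted at hacc
  have hnorm : t.A * (2 ^ i / 2 * L * ‖t.y - t.x‖ ^ 2) = ‖t.xhat - v‖ ^ 2 / 2 := by
    rw [hdiff, norm_smul, Real.norm_of_nonneg hτ0.le]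
    linear_combination ‖t.xhat - v‖ ^ 2 / 2 * ht.mul_τ_sq hA hL
  have h1 := mul_le_mul_of_nonneg_left hacc hApos.le
  have h2 := mul_le_mul_of_nonneg_left hgy hApos.le
  have h3 := mul_le_mul_of_nonneg_left hsub hA
  have hτA := ht.τ_mul_A hA
  have hAeq := ht.A_eq
  have e1 : t.A * (1 - t.τ) = A := by linarith
  -- The tolerance `ε τ/2` becomes `ε a/2`; summed over iterations, this is the `ε/2` in the
  -- invariant.
  have h4 : t.A * (q t.x + reInner t.u (t.y - t.x) + 2 ^ i / 2 * L * ‖t.y - t.x‖ ^ 2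
      + ε / 2 * t.τ) = t.A * q t.x + t.a * reInner t.u (t.xhat - t.x)
      + A * reInner t.u (y - t.x) + ‖t.xhat - v‖ ^ 2 / 2 + ε / 2 * t.a := by
    rw [hinner, ← hnorm, ← e1, ← hτA]
    ring
  have h5 : t.A * (t.τ * (g t.xhat).toReal + (1 - t.τ) * (g y).toReal) =
      t.a * (g t.xhat).toReal + A * (g y).toReal := by
    rw [← e1, ← hτA]
    ring
  rw [h4] at h1
  rw [h5] at h2
  rw [hAeq] at h1 h2 ⊢
  rw [reInner_sub_right] at h1 ⊢
  linarith

/-! ### Invariants of a run -/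

section Run

variable {ε L₀ : ℝ} {x₀ : CVec n} {N : ℕ} {r : Run n}

theorem IsRun.invariants (hr : IsRun Q q g ε L₀ x₀ N r) (hg : IsProperClosedConvex g)
    (hQg : Q ⊆ effectiveDomain g) (hQ : Convex ℝ Q) (hL₀ : 0 < L₀) (hx₀ : x₀ ∈ Q) :
    ∀ k ≤ N, r.y k ∈ Q ∧ 0 ≤ r.A k ∧ 0 < r.L k ∧ IsCompositeOn g Q (r.A k) (r.φ k) := by
  intro k
  induction k with
  | zero =>
    intro _
    rw [hr.y_zero, hr.A_zero, hr.L_zero]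
    exact ⟨hx₀, le_rfl, hL₀, 0, 0, fun z _ => by simp [hr.φ_zero, reInner]⟩
  | succ k ih =>
    intro hk
    obtain ⟨hy, hA, hL, hφ⟩ := ih (by omega)
    have ht := hr.trials k hk _ le_rfl
    have := ht.a_pos
    rw [hr.y_succ k hk, hr.A_succ k hk, hr.L_succ k hk]
    exact ⟨ht.y_mem hQ hA hy, by linarith, by positivity,
      (hφ.add_model hg hQg (hr.φ_succ k hk)).1⟩

theorem IsRun.estimates (hr : IsRun Q q g ε L₀ x₀ N r) (hg : IsProperClosedConvex g)
    (hQg : Q ⊆ effectiveDomain g) (hQ : Convex ℝ Q) (hL₀ : 0 < L₀) (hx₀ : x₀ ∈ Q) :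
    ∀ k ≤ N, ∀ z ∈ Q,
      r.A k * (q (r.y k) + (g (r.y k)).toReal - ε / 2) ≤ (r.φ k z).toReal + ‖x₀ - z‖ ^ 2 / 2 ∧
      (r.φ k z).toReal ≤ r.A k * (q z + (g z).toReal) := by
  intro k
  induction k with
  | zero =>
    intro _ z _
    rw [hr.A_zero, hr.φ_zero]
    simp only [zero_mul, EReal.toReal_zero, zero_add, le_refl, and_true]
    positivity
  | succ k ih =>
    intro hk z hz
    obtain ⟨hy, hA, hL, hφ⟩ := hr.invariants hg hQg hQ hL₀ hx₀ k (by omega)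
    have ht := hr.trials k hk _ le_rfl
    have hest := fun z hz => (ih (by omega) z hz).1
    have hle := (ih (by omega) z hz).2
    have hsub := mul_le_mul_of_nonneg_left (ht.u_mem z) ht.a_pos.le
    rw [(hφ.add_model hg hQg (hr.φ_succ k hk)).2 z hz, hr.y_succ k hk, hr.x_succ k hk,
      hr.A_succ k hk]
    refine ⟨?_, by linarith⟩
    rw [← ht.A_eq]
    exact ht.estimate hg hQg hQ (hr.accepted k hk) hA hL hy hφ (hr.v_prox k hk) hest hz

/-- Rejection of pass `j` bounds `2^j L` from above in terms of its `τ`, which is at least that of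
pass `j + 1`. If pass `j + 1` is accepted, the halving in the update makes `2^j L` the next `L`. -/
theorem IsHolderSmooth.log_le_of_rejected {ν M : ℝ} (hq : IsHolderSmooth q Q ν M)
    (hQ : Convex ℝ Q) (hν0 : 0 ≤ ν) (hν1 : ν ≤ 1) (hM : 0 < M) {v y : CVec n} {A L : ℝ} {j : ℕ}
    {s t : Trial n} (hv : v ∈ Q) (hy : y ∈ Q) (hA : 0 ≤ A) (hL : 0 < L) (hε : 0 < ε)
    (hs : IsTrial Q q g v y A L j s) (hrej : ¬ Accepted q ε L j s)
    (ht : IsTrial Q q g v y A L (j + 1) t) :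
    (1 + 3 * ν) * Real.log (2 ^ j * L) + 2 * (1 - ν) * Real.log ε ≤
      4 * Real.log M + (1 - ν) * (Real.log 2 + Real.log t.A) := by
  have h1 := not_le.1 fun h => hrej (hq.accepted hQ hν0 hν1 hM hv hy hA hL hε hs h)
  have h2 := Real.log_le_log (ht.τ_pos hA) (hs.τ_anti ht hA hL (Nat.le_succ j))
  have h3 := ht.log_a hL
  have h4 : Real.log (2 ^ (j + 1) * L) = Real.log 2 + Real.log (2 ^ j * L) := by
    rw [← Real.log_mul two_ne_zero (by positivity)]
    congr 1
    ring
  rw [ht.log_τ hA] at h2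
  have h5 := mul_le_mul_of_nonneg_left h2 (sub_nonneg.2 hν1)
  have h6 : Real.log t.a = (Real.log t.A - Real.log 2 - Real.log (2 ^ j * L)) / 2 := by linarith
  rw [h6] at h5
  linarith

/-- The line search keeps the quadratic coefficients below a multiple of a power of `A`. -/
theorem IsRun.log_L_le {ν M : ℝ} (hr : IsRun Q q g ε L₀ x₀ N r) (hq : IsHolderSmooth q Q ν M)
    (hg : IsProperClosedConvex g) (hQg : Q ⊆ effectiveDomain g) (hQ : Convex ℝ Q)
    (hν0 : 0 ≤ ν) (hν1 : ν ≤ 1) (hM : 0 < M) (hε : 0 < ε) (hL₀ : 0 < L₀) (hx₀ : x₀ ∈ Q)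
    (hL₀le : (1 + ν) * (Real.log L₀ - Real.log 2) + (1 - ν) * Real.log ε ≤ 2 * Real.log M) :
    ∀ k < N, (1 + 3 * ν) * Real.log (r.L (k + 1)) + 2 * (1 - ν) * Real.log ε ≤
      4 * Real.log M + (1 - ν) * (Real.log 2 + Real.log (r.A (k + 1))) := by
  intro k
  induction k with
  | zero =>
    intro hk
    obtain ⟨hy, hA, hL, -⟩ := hr.invariants hg hQg hQ hL₀ hx₀ 0 (by omega)
    have ht := hr.trials 0 hk _ le_rfl
    have hrej := hr.rejected 0 hk
    rw [hr.L_succ 0 hk, hr.A_succ 0 hk, ← ht.A_eq]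
    rcases hi : r.i 0 with _ | j
    · rw [hi] at ht
      have h1 := ht.log_a hL
      -- Here no rejected pass is available. As `A_0 = 0`, the first weight is `1/L₀`, and the upper
      -- bound on `L₀` supplies the estimate.
      have h2 : (r.trial 0 0).a = (r.trial 0 0).A := by rw [ht.A_eq, hr.A_zero, zero_add]
      rw [h2, hr.L_zero, pow_zero, one_mul] at h1
      rw [hr.L_zero, pow_zero, div_mul_eq_mul_div, one_mul,
        Real.log_div hL₀.ne' two_ne_zero]
      have h3 : Real.log (r.trial 0 0).A = -Real.log L₀ := by linarith
      rw [h3]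
      linarith
    · rw [hi] at ht hrej
      convert! hq.log_le_of_rejected hQ hν0 hν1 hM (hr.v_prox 0 hk).1 hy hA hL hε
        (hr.trials 0 hk j (by omega)) (hrej j (by omega)) ht using 4
      ring
  | succ k ih =>
    intro hk
    obtain ⟨hy, hA, hL, -⟩ := hr.invariants hg hQg hQ hL₀ hx₀ (k + 1) (by omega)
    have ht := hr.trials (k + 1) hk _ le_rfl
    have hrej := hr.rejected (k + 1) hk
    have ih := ih (by omega)
    have hApos : 0 < r.A (k + 1) := by
      have ht := hr.trials k (by omega) _ le_rfl
      rw [hr.A_succ k (by omega)]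
      linarith [ht.a_pos, (hr.invariants hg hQg hQ hL₀ hx₀ k (by omega)).2.1]
    rw [hr.L_succ (k + 1) hk, hr.A_succ (k + 1) hk]
    rcases hi : r.i (k + 1) with _ | j
    · rw [hi] at ht
      -- Without a rejection `L` is halved while `A` increases, so the induction hypothesis carries
      -- over.
      have h1 : Real.log (r.A (k + 1)) ≤
          Real.log (r.A (k + 1) + (r.trial (k + 1) 0).a) :=
        Real.log_le_log hApos (by linarith [ht.a_pos])
      have h2 := mul_le_mul_of_nonneg_left h1 (sub_nonneg.2 hν1)
      have h3 : Real.log (2 ^ 0 / 2 * r.L (k + 1)) ≤ Real.log (r.L (k + 1)) :=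
        Real.log_le_log (by positivity) (by linarith)
      have h4 := mul_le_mul_of_nonneg_left h3 (show 0 ≤ 1 + 3 * ν by linarith)
      linarith
    · rw [hi] at ht hrej
      rw [← ht.A_eq]
      convert! hq.log_le_of_rejected hQ hν0 hν1 hM (hr.v_prox (k + 1) hk).1 hy hA hL hε
        (hr.trials (k + 1) hk j (by omega)) (hrej j (by omega)) ht using 4
      ring

/-! ### The rate of growth of the weights -/

/-- If the increment `a` dominates `c (A + a) ^ (1 - θ)`, then `A ^ θ` grows by at least `c θ`. -/
theorem rpow_add_le_rpow {A a c θ : ℝ} (hA : 0 ≤ A) (ha : 0 < a) (hc : 0 < c) (hθ0 : 0 ≤ θ)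
    (hθ1 : θ ≤ 1) (h : Real.log c + (1 - θ) * Real.log (A + a) ≤ Real.log a) :
    A ^ θ + θ * c ≤ (A + a) ^ θ := by
  have hS : 0 < A + a := by linarith
  have h1 : c * (A + a) ^ (1 - θ) ≤ a := by
    rw [← Real.log_le_log_iff (by positivity) ha, Real.log_mul hc.ne' (by positivity),
      Real.log_rpow hS]
    exact h
  -- Bernoulli's inequality for exponents in `[0, 1]` bounds `(A/(A+a))^θ` by `1 - θ a/(A+a)`.
  have h2 := rpow_one_add_le_one_add_mul_self (s := -(a / (A + a)))
    (by rw [neg_le_neg_iff, div_le_one hS]; linarith) hθ0 hθ1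
  have h3 : A = (A + a) * (1 + -(a / (A + a))) := by field_simp; ring
  have h4 : 0 ≤ 1 + -(a / (A + a)) := by
    have : a / (A + a) ≤ 1 := by rw [div_le_one hS]; linarith
    linarith
  have h5 : c ≤ (A + a) ^ θ * (a / (A + a)) := by
    rw [← mul_div_assoc, le_div_iff₀ hS]
    calc c * (A + a) = c * (A + a) ^ (1 - θ) * (A + a) ^ θ := by
          rw [mul_assoc, ← Real.rpow_add hS, sub_add_cancel, Real.rpow_one]
      _ ≤ a * (A + a) ^ θ := mul_le_mul_of_nonneg_right h1 (by positivity)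
      _ = (A + a) ^ θ * a := mul_comm _ _
  have h6 : A ^ θ = (A + a) ^ θ * (1 + -(a / (A + a))) ^ θ := by
    conv_lhs => rw [h3]
    exact Real.mul_rpow hS.le h4
  rw [h6]
  have h7 := mul_le_mul_of_nonneg_left h2 (show 0 ≤ (A + a) ^ θ by positivity)
  have h8 := mul_le_mul_of_nonneg_left h5 hθ0
  linarith

/-- The constant `c` is the one for which the bound on `L_{k+1}` becomes `a ≥ c A_{k+1}^(1-θ)`. Each
step adds at least `θ c` to `A^θ`, and `θ ≥ 1/2`. -/
theorem IsRun.growth {ν M : ℝ} (hr : IsRun Q q g ε L₀ x₀ N r) (hq : IsHolderSmooth q Q ν M)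
    (hg : IsProperClosedConvex g) (hQg : Q ⊆ effectiveDomain g) (hQ : Convex ℝ Q)
    (hν0 : 0 ≤ ν) (hν1 : ν ≤ 1) (hM : 0 < M) (hε : 0 < ε) (hL₀ : 0 < L₀) (hx₀ : x₀ ∈ Q)
    (hL₀le : (1 + ν) * (Real.log L₀ - Real.log 2) + (1 - ν) * Real.log ε ≤ 2 * Real.log M)
    {c : ℝ} (hc : 0 < c) (hlogc : (1 + 3 * ν) * Real.log c =
      (1 - ν) * Real.log ε - (1 + ν) * Real.log 2 - 2 * Real.log M) :
    ∀ k ≤ N, k * (c / 2) ≤ r.A k ^ ((1 + ν) / (1 + 3 * ν)) := by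
  have hν3 : 0 < 1 + 3 * ν := by linarith
  have hθ1 : (1 + ν) / (1 + 3 * ν) ≤ 1 := by rw [div_le_one hν3]; linarith
  have hθ2 : 1 / 2 ≤ (1 + ν) / (1 + 3 * ν) := by rw [div_le_div_iff₀ two_pos hν3]; linarith
  have hθ3 : (1 + 3 * ν) * ((1 + ν) / (1 + 3 * ν)) = 1 + ν := mul_div_cancel₀ _ hν3.ne'
  set θ := (1 + ν) / (1 + 3 * ν)
  intro k
  induction k with
  | zero =>
    intro _
    rw [hr.A_zero, Real.zero_rpow (by linarith)]
    simp
  | succ k ih =>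
    intro hk
    have ih := ih (by omega)
    obtain ⟨hy, hA, hL, -⟩ := hr.invariants hg hQg hQ hL₀ hx₀ k (by omega)
    have ht := hr.trials k hk _ le_rfl
    have hlog := hr.log_L_le hq hg hQg hQ hν0 hν1 hM hε hL₀ hx₀ hL₀le k hk
    have hloga := ht.log_a hL
    have hL' : Real.log (2 ^ r.i k * r.L k) = Real.log 2 + Real.log (r.L (k + 1)) := by
      rw [hr.L_succ k hk, ← Real.log_mul two_ne_zero (by positivity)]
      congr 1
      ring
    rw [ht.A_eq, ← hr.A_succ k hk, hL'] at hloga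
    have hstep : Real.log c + (1 - θ) * Real.log (r.A (k + 1)) ≤
        Real.log (r.trial k (r.i k)).a := by
      refine le_of_mul_le_mul_left ?_ hν3
      have e1 : Real.log (r.L (k + 1)) =
        Real.log (r.A (k + 1)) - Real.log 2 - 2 * Real.log (r.trial k (r.i k)).a := by linarith
      have e2 : (1 + 3 * ν) * (Real.log c + (1 - θ) * Real.log (r.A (k + 1))) =
          (1 + 3 * ν) * Real.log c + (1 + 3 * ν - (1 + ν)) * Real.log (r.A (k + 1)) := by
        rw [← hθ3]; ring
      rw [e1] at hlog
      rw [e2, hlogc]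
      linarith
    rw [hr.A_succ k hk] at hstep ⊢
    have := rpow_add_le_rpow hA ht.a_pos hc (by linarith) hθ1 hstep
    push_cast
    nlinarith

end Run

/-! ### Existence of runs -/

/-- The data that one iteration hands over to the next. -/
structure State (n : ℕ) where
  x : CVec n
  y : CVec n
  A : ℝ
  L : ℝ
  φ : CVec n → EReal

/-- The invariants of a state that make the next iteration possible. -/
structure State.IsAdmissible (Q : Set (CVec n)) (g : CVec n → EReal) (s : State n) : Prop where
  y_mem : s.y ∈ Q
  A_nonneg : 0 ≤ s.A
  L_pos : 0 < s.L
  composite : IsCompositeOn g Q s.A s.φ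

/-- The state after an iteration that accepts the trial `t` at pass number `i`. -/
def State.next (q : CVec n → ℝ) (g : CVec n → EReal) (s : State n) (i : ℕ) (t : Trial n) :
    State n where
  x := t.x
  y := t.y
  A := s.A + t.a
  L := 2 ^ i / 2 * s.L
  φ z := s.φ z + (t.a : EReal) * (((q t.x + reInner t.u (z - t.x) : ℝ) : EReal) + g z)

theorem State.IsAdmissible.next (hg : IsProperClosedConvex g) (hQg : Q ⊆ effectiveDomain g)
    (hQ : Convex ℝ Q) {s : State n} (hs : s.IsAdmissible Q g) {v : CVec n} {i : ℕ} {t : Trial n}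
    (ht : IsTrial Q q g v s.y s.A s.L i t) : (s.next q g i t).IsAdmissible Q g where
  y_mem := ht.y_mem hQ hs.A_nonneg hs.y_mem
  A_nonneg := add_nonneg hs.A_nonneg ht.a_pos.le
  L_pos := mul_pos (by positivity) hs.L_pos
  composite := (hs.composite.add_model hg hQg fun _ => rfl).1

theorem State.IsAdmissible.exists_iteration {ν M ε : ℝ} (hq : IsHolderSmooth q Q ν M)
    (hg : IsProperClosedConvex g) (hQg : Q ⊆ effectiveDomain g) (hQcl : IsClosed Q)
    (hQ : Convex ℝ Q) (hν0 : 0 ≤ ν) (hν1 : ν ≤ 1) (hM : 0 < M) (hε : 0 < ε) (x₀ : CVec n)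
    {s : State n} (hs : s.IsAdmissible Q g) {G : ℕ → CVec n → CVec n}
    (hG : ∀ j, ∀ z ∈ Q, G j z ∈ subdifferential q z) :
    ∃ (v : CVec n) (i : ℕ) (t : ℕ → Trial n), IsProx s.φ Q x₀ v ∧
      (∀ j, IsTrial Q q g v s.y s.A s.L j (t j)) ∧ (∀ j, (t j).u = G j (t j).x) ∧
      (∀ j < i, ¬ Accepted q ε s.L j (t j)) ∧ Accepted q ε s.L i (t i) := by
  classical
  obtain ⟨v, hv⟩ := hg.exists_isProx hQg ⟨_, hs.y_mem⟩ hQcl hQ hs.A_nonneg hs.composite x₀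
  -- All passes are constructed, including those after the stopping index, which is then the least
  -- accepted one.
  choose t ht htu using fun j =>
    exists_isTrial hg hQg hQcl hQ hv.1 hs.y_mem hs.A_nonneg hs.L_pos j (G j) (hG j)
  have hacc := hq.exists_accepted hQ hν0 hν1 hM hv.1 hs.y_mem hs.A_nonneg hs.L_pos hε ht
  exact ⟨v, Nat.find hacc, t, hv, ht, htu, fun j hj => Nat.find_min hacc hj, Nat.find_spec hacc⟩

/-- The method can be run for any number of iterations, whatever subgradients are chosen. -/
theorem exists_isRun {ν M ε L₀ : ℝ} (hq : IsHolderSmooth q Q ν M)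
    (hg : IsProperClosedConvex g) (hQg : Q ⊆ effectiveDomain g) (hQcl : IsClosed Q)
    (hQ : Convex ℝ Q) (hν0 : 0 ≤ ν) (hν1 : ν ≤ 1) (hM : 0 < M) (hε : 0 < ε) (hL₀ : 0 < L₀)
    {x₀ : CVec n} (hx₀ : x₀ ∈ Q) {G : ℕ → ℕ → CVec n → CVec n}
    (hG : ∀ k j, ∀ z ∈ Q, G k j z ∈ subdifferential q z) :
    ∃ r : Run n, ∀ N, IsRun Q q g ε L₀ x₀ N r ∧
      ∀ k j, (r.trial k j).u = G k j (r.trial k j).x := by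
  choose v i t hv ht htu hrej hacc using fun (k : ℕ) (s : {s : State n // s.IsAdmissible Q g}) =>
    s.2.exists_iteration hq hg hQg hQcl hQ hν0 hν1 hM hε x₀ (hG k)
  let s₀ : {s : State n // s.IsAdmissible Q g} :=
    ⟨⟨x₀, x₀, 0, L₀, fun _ => 0⟩, hx₀, le_rfl, hL₀, 0, 0, fun z _ => by simp [reInner]⟩
  -- Bundling each state with its admissibility lets the one-step choices be iterated; the resulting
  -- infinite run serves every `N`.
  let S : ℕ → {s : State n // s.IsAdmissible Q g} := fun k => Nat.rec s₀
    (fun k s => ⟨s.1.next q g (i k s) (t k s (i k s)), s.2.next hg hQg hQ (ht k s _)⟩) k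
  refine ⟨⟨fun k => v k (S k), fun k => (S k).1.x, fun k => (S k).1.y, fun k => (S k).1.A,
    fun k => (S k).1.L, fun k => (S k).1.φ, fun k => i k (S k), fun k => t k (S k)⟩,
    fun N => ⟨?_, fun k j => htu k (S k) j⟩⟩
  exact {
    x_zero := rfl
    y_zero := rfl
    A_zero := rfl
    L_zero := rfl
    φ_zero := fun _ => rfl
    v_prox := fun k _ => hv k (S k)
    trials := fun k _ j _ => ht k (S k) j
    rejected := fun k _ => hrej k (S k)
    accepted := fun k _ => hacc k (S k)
    x_succ := fun _ _ => rfl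
    y_succ := fun _ _ => rfl
    A_succ := fun _ _ => rfl
    L_succ := fun _ _ => rfl
    φ_succ := fun _ _ _ => rfl }

/-! ### Accuracy of the output -/

theorem log_le_of_le {ν M ε L₀ : ℝ} (hν0 : 0 ≤ ν) (hM : 0 < M) (hε : 0 < ε) (hL₀ : 0 < L₀)
    (h : L₀ ≤ 2 * M ^ (2 / (1 + ν)) / ε ^ ((1 - ν) / (1 + ν))) :
    (1 + ν) * (Real.log L₀ - Real.log 2) + (1 - ν) * Real.log ε ≤ 2 * Real.log M := by
  have h1 := Real.log_le_log hL₀ h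
  rw [Real.log_div (by positivity) (by positivity), Real.log_mul two_ne_zero (by positivity),
    Real.log_rpow hM, Real.log_rpow hε] at h1
  have hν : 0 < 1 + ν := by linarith
  have h2 := mul_le_mul_of_nonneg_left h1 hν.le
  have h3 : (1 + ν) * (Real.log 2 + 2 / (1 + ν) * Real.log M - (1 - ν) / (1 + ν) * Real.log ε) =
      (1 + ν) * Real.log 2 + 2 * Real.log M - (1 - ν) * Real.log ε := by field_simp
  linarith

/-- After `iterationCount ν M δ ε` iterations, the weight is at least `δ² / ε`. -/
theorem IsRun.sq_le_mul_A {ν M δ ε L₀ : ℝ} {x₀ : CVec n} {r : Run n}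
    (hr : IsRun Q q g ε L₀ x₀ (iterationCount ν M δ ε) r) (hq : IsHolderSmooth q Q ν M)
    (hg : IsProperClosedConvex g) (hQg : Q ⊆ effectiveDomain g) (hQ : Convex ℝ Q)
    (hν0 : 0 ≤ ν) (hν1 : ν ≤ 1) (hM : 0 < M) (hδ : 0 < δ) (hε : 0 < ε) (hL₀ : 0 < L₀)
    (hx₀ : x₀ ∈ Q) (hL₀le : L₀ ≤ 2 * M ^ (2 / (1 + ν)) / ε ^ ((1 - ν) / (1 + ν))) :
    0 < r.A (iterationCount ν M δ ε) ∧ δ ^ 2 ≤ ε * r.A (iterationCount ν M δ ε) := by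
  have hν3 : 0 < 1 + 3 * ν := by linarith
  set c := Real.exp (((1 - ν) * Real.log ε - (1 + ν) * Real.log 2 - 2 * Real.log M) / (1 + 3 * ν))
    with hc
  have hlogc : (1 + 3 * ν) * Real.log c =
      (1 - ν) * Real.log ε - (1 + ν) * Real.log 2 - 2 * Real.log M := by
    rw [hc, Real.log_exp, mul_div_cancel₀ _ hν3.ne']
  have hgrow := hr.growth hq hg hQg hQ hν0 hν1 hM hε hL₀ hx₀
    (log_le_of_le hν0 hM hε hL₀ hL₀le) (Real.exp_pos _) hlogc _ le_rfl
  obtain ⟨-, hA, -, -⟩ := hr.invariants hg hQg hQ hL₀ hx₀ _ le_rfl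
  set N := iterationCount ν M δ ε with hN
  set X := (2 : ℝ) ^ ((2 + 4 * ν) / (1 + 3 * ν)) * M ^ (2 / (1 + 3 * ν)) *
    δ ^ ((2 + 2 * ν) / (1 + 3 * ν)) / ε ^ (2 / (1 + 3 * ν)) with hX
  have hXpos : 0 < X := by positivity
  -- The count is calibrated so that `X * (c / 2) = (δ²/ε)^θ` with `θ = (1+ν)/(1+3ν)`: the powers of
  -- `2` and `M` cancel.
  have hXA : X * (c / 2) ≤ r.A N ^ ((1 + ν) / (1 + 3 * ν)) :=
    (mul_le_mul_of_nonneg_right (Nat.le_ceil X) (by positivity)).trans hgrow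
  have hApos : 0 < r.A N := by
    refine hA.lt_of_ne fun h0 => ?_
    rw [← h0, Real.zero_rpow (by positivity)] at hXA
    exact absurd hXA (not_le.2 (by positivity))
  refine ⟨hApos, ?_⟩
  have hlog := Real.log_le_log (by positivity) hXA
  rw [Real.log_rpow hApos, Real.log_mul hXpos.ne' (by positivity),
    Real.log_div (by positivity) two_ne_zero, hX, Real.log_div (by positivity) (by positivity),
    Real.log_mul (by positivity) (by positivity), Real.log_mul (by positivity) (by positivity),
    Real.log_rpow two_pos, Real.log_rpow hM, Real.log_rpow hδ, Real.log_rpow hε] at hlog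
  rw [← Real.log_le_log_iff (by positivity) (by positivity), Real.log_pow,
    Real.log_mul hε.ne' hApos.ne']
  have h1 := mul_le_mul_of_nonneg_left hlog hν3.le
  have h2 : (1 + 3 * ν) * ((2 + 4 * ν) / (1 + 3 * ν) * Real.log 2 + 2 / (1 + 3 * ν) * Real.log M +
      (2 + 2 * ν) / (1 + 3 * ν) * Real.log δ - 2 / (1 + 3 * ν) * Real.log ε +
      (Real.log c - Real.log 2)) =
      (2 + 4 * ν) * Real.log 2 + 2 * Real.log M + (2 + 2 * ν) * Real.log δ - 2 * Real.log ε +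
      ((1 + 3 * ν) * Real.log c - (1 + 3 * ν) * Real.log 2) := by field_simp
  have h3 : (1 + 3 * ν) * ((1 + ν) / (1 + 3 * ν) * Real.log (r.A N)) =
      (1 + ν) * Real.log (r.A N) := by field_simp
  rw [h2, h3, hlogc] at h1
  refine le_of_mul_le_mul_left ?_ (show 0 < 1 + ν by linarith)
  push_cast
  linarith

/-- The output of every run is feasible and `ε`-optimal. -/
theorem IsRun.output {ν M δ ε L₀ : ℝ} {x₀ : CVec n} {r : Run n}
    (hr : IsRun Q q g ε L₀ x₀ (iterationCount ν M δ ε) r) (hq : IsHolderSmooth q Q ν M)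
    (hg : IsProperClosedConvex g) (hQg : Q ⊆ effectiveDomain g) (hQcl : IsClosed Q)
    (hQ : Convex ℝ Q) (hX : (minimizers (objective q g) Q).Nonempty)
    (hν0 : 0 ≤ ν) (hν1 : ν ≤ 1) (hM : 0 < M) (hδ : 0 ≤ δ) (hε : 0 < ε) (hL₀ : 0 < L₀)
    (hx₀ : x₀ ∈ Q) (hL₀le : L₀ ≤ 2 * M ^ (2 / (1 + ν)) / ε ^ ((1 - ν) / (1 + ν)))
    (hdist : Metric.infDist x₀ (minimizers (objective q g) Q) ≤ δ) :
    r.y (iterationCount ν M δ ε) ∈ Q ∧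
      objective q g (r.y (iterationCount ν M δ ε)) - optimalValue (objective q g) Q ≤
        (ε : EReal) := by
  obtain ⟨hy, -, -, -⟩ := hr.invariants hg hQg hQ hL₀ hx₀ _ le_rfl
  refine ⟨hy, ?_⟩
  have hqc : Continuous q := continuousOn_univ.1 (hq.convex.continuousOn isOpen_univ)
  obtain ⟨x, hx, hxd⟩ := (hg.isClosed_minimizers hQg hQcl hqc hX).exists_infDist_eq_dist hX x₀
  rw [hxd, dist_eq_norm] at hdist
  rw [optimalValue_eq_of_mem_minimizers hx, hg.objective_eq hQg q hx.1,
    hg.objective_eq hQg q hy, ← EReal.coe_sub, EReal.coe_le_coe_iff]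
  -- For `δ = 0` no iteration is made, and the output `x₀` is itself a minimizer.
  rcases hδ.eq_or_lt with rfl | hδ
  · have hN : iterationCount ν M 0 ε = 0 := by
      have : (2 + 2 * ν) / (1 + 3 * ν) ≠ 0 := by positivity
      simp [iterationCount, Real.zero_rpow this]
    have hxx : x₀ = x := sub_eq_zero.1 (norm_le_zero_iff.1 hdist)
    have hyx : r.y (iterationCount ν M 0 ε) = x := by rw [hN, hr.y_zero, hxx]
    rw [hyx, sub_self]
    exact hε.le
  · obtain ⟨hApos, hA⟩ := hr.sq_le_mul_A hq hg hQg hQ hν0 hν1 hM hδ hε hL₀ hx₀ hL₀le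
    obtain ⟨h1, h2⟩ := hr.estimates hg hQg hQ hL₀ hx₀ _ le_rfl x hx.1
    have h3 : ‖x₀ - x‖ ^ 2 ≤ δ ^ 2 := pow_le_pow_left₀ (norm_nonneg _) hdist 2
    -- The two estimates at `x` give `A (f(y) - f̂) ≤ A ε/2 + δ²/2`, and `δ² ≤ ε A`.
    refine le_of_mul_le_mul_left ?_ hApos
    linarith

end UFGM

end

theorem mainTheorem10 (n : ℕ) (Q : Set (UFGM.CVec n)) (hQne : Q.Nonempty) (hQcl : IsClosed Q)
    (hQconv : Convex ℝ Q) (ν M : ℝ) (hν0 : 0 ≤ ν) (hν1 : ν ≤ 1) (hM : 0 < M)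
    (q : UFGM.CVec n → ℝ) (hq : UFGM.IsHolderSmooth q Q ν M)
    (g : UFGM.CVec n → EReal) (hg : UFGM.IsProperClosedConvex g)
    (hQg : Q ⊆ UFGM.effectiveDomain g)
    (hX : (UFGM.minimizers (UFGM.objective q g) Q).Nonempty) :
    (∀ (δ ε L₀ : ℝ) (x₀ : UFGM.CVec n), 0 ≤ δ → 0 < ε → 0 < L₀ → x₀ ∈ Q →
      -- the method can be run for the stated number of iterations, however the subgradients
      -- are chosen (every proximal point exists and every line search stops)
      (∀ G : ℕ → ℕ → UFGM.CVec n → UFGM.CVec n,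
        (∀ k j, ∀ z ∈ Q, G k j z ∈ UFGM.subdifferential q z) →
        ∃ r : UFGM.Run n, UFGM.IsRun Q q g ε L₀ x₀ (UFGM.iterationCount ν M δ ε) r ∧
          ∀ k < UFGM.iterationCount ν M δ ε, ∀ j ≤ r.i k,
            (r.trial k j).u = G k j (r.trial k j).x) ∧
      -- if `L₀` is not too large and `d(x₀, X̂) ≤ δ`, the output of every run is feasible and `ε`-optimal
      (L₀ ≤ 2 * M ^ (2 / (1 + ν)) / ε ^ ((1 - ν) / (1 + ν)) →
        Metric.infDist x₀ (UFGM.minimizers (UFGM.objective q g) Q) ≤ δ →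
        ∀ r : UFGM.Run n, UFGM.IsRun Q q g ε L₀ x₀ (UFGM.iterationCount ν M δ ε) r →
          r.y (UFGM.iterationCount ν M δ ε) ∈ Q ∧
          UFGM.objective q g (r.y (UFGM.iterationCount ν M δ ε)) -
            UFGM.optimalValue (UFGM.objective q g) Q ≤ (ε : EReal))) ∧
    -- the growth exponents of the cost
    (0 < (2 + 2 * ν) / (1 + 3 * ν) ∧ 0 < 2 / (1 + 3 * ν) ∧
      ∃ C : ℝ, C = (2 : ℝ) ^ ((2 + 4 * ν) / (1 + 3 * ν)) * M ^ (2 / (1 + 3 * ν)) ∧ 0 < C ∧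
        ∀ δ ε : ℝ, 0 < δ → 0 < ε →
          (UFGM.iterationCount ν M δ ε : ℝ) ≤
            C * δ ^ ((2 + 2 * ν) / (1 + 3 * ν)) / ε ^ (2 / (1 + 3 * ν)) + 1) := by
  have hν3 : 0 < 1 + 3 * ν := by linarith
  refine ⟨fun δ ε L₀ x₀ hδ hε hL₀ hx₀ => ⟨fun G hG => ?_, fun hL₀le hdist r hr =>
    hr.output hq hg hQg hQcl hQconv hX hν0 hν1 hM hδ hε hL₀ hx₀ hL₀le hdist⟩,
    by positivity, by positivity, _, rfl, by positivity, fun δ ε hδ hε => ?_⟩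
  · obtain ⟨r, hr⟩ := UFGM.exists_isRun hq hg hQg hQcl hQconv hν0 hν1 hM hε hL₀ hx₀ hG
    exact ⟨r, (hr _).1, fun k _ j _ => (hr 0).2 k j⟩
  · exact (Nat.ceil_lt_add_one (by positivity)).le
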